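/- Let $n\ge 2$ be even. Let $B_k$ be the Bernoulli numbers, $\sum_k B_k t^k/k! = t/(e^t-1)$, and for $m=(m_1,\dots,m_n)\in\mathbb Z_{\ge0}^n$ write $|m|=m_1+\cdots+m_n$ and $\frac{B_m}{m!}=\prod_{i=1}^n \frac{B_{m_i}}{m_i!}$. Let $d=d_{n,n}$ be the least common multiple of the denominators of the coefficients of the homogeneous part of degree $n$ of the Todd power series $\prod_{i=1}^n \frac{x_i}{1-e^{-x_i}}=\sum_m (-1)^{|m|}\frac{B_m}{m!}x_1^{m_1}\cdots x_n^{m_n}$; in particular $d\,B_m/m!\in\mathbb Z$ whenever $|m|=n$. Let $q\ge 1$ and let $p_1,\dots,p_{n-1}$ be integers coprime to $q$. Put $$c(q;p_1,\dots,p_{n-1})=\sum_{k=1}^{q-1}\cot\frac{\pi k}{q}\cot\frac{\pi p_1k}{q}\cdots\cot\frac{\pi p_{n-1}k}{q},\qquad d(q;p_1,\dots,p_{n-1})=(-1)^{n/2}\,c(q;p_1,\dots,p_{n-1}).$$ Then $\frac{d}{2^n}\,c(q;p_1,\dots,p_{n-1})$ and $\frac{d}{2^n}\,d(q;p_1,\dots,p_{n-1})$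 are integers, and $$\frac{d}{2^n}\,c(q;p_1,\dots,p_{n-1})\equiv(-1)^{\frac n2+1}\sum_m d\,\frac{B_m}{m!}\prod_{i=1}^{n-1}p_i^{m_i-1}\pmod q,$$ equivalently $$\frac{d}{2^n}\,d(q;p_1,\dots,p_{n-1})\equiv-\sum_m d\,\frac{B_m}{m!}\prod_{i=1}^{n-1}p_i^{m_i-1}\pmod q,$$ where $m$ runs over the $n$-tuples of non-negative even integers with $|m|=n$, and $p_i^{-1}$ denotes an inverse of $p_i$ modulo $q$. -/

import Mathlib

namespace DedekindZagier

/-- The Todd power series in one variable, `x / (1 - e^{-x}) = ∑ (-1)^k B_k / k! x^k`,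
where `B_1 = -1/2`. -/
noncomputable def toddSeries : PowerSeries ℚ :=
  PowerSeries.mk fun k => (-1) ^ k * (bernoulli k / (k.factorial : ℚ))

/-- The series above is indeed `x / (1 - e^{-x})`. -/
theorem toddSeries_mul :
    toddSeries * (1 - PowerSeries.evalNegHom (PowerSeries.exp ℚ)) = PowerSeries.X := by
  have h := congrArg PowerSeries.evalNegHom (bernoulliPowerSeries_mul_exp_sub_one ℚ)
  have hs : PowerSeries.evalNegHom (bernoulliPowerSeries ℚ) = toddSeries := by
    ext k
    simp [PowerSeries.evalNegHom, PowerSeries.coeff_rescale, bernoulliPowerSeries, toddSeries]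
  have hX : PowerSeries.evalNegHom (PowerSeries.X : PowerSeries ℚ) = -PowerSeries.X := by
    simp [PowerSeries.evalNegHom]
  rw [map_mul, map_sub, map_one, hs, hX] at h
  linear_combination -h

/-- The Todd power series in `n` variables, `∏ i, x_i / (1 - e^{-x_i})`: the coefficient of
`x^r` is the product of the coefficients of `x_i^{r_i}` in the one-variable series. -/
noncomputable def toddSeriesMv (n : ℕ) : MvPowerSeries (Fin n) ℚ :=
  fun r => ∏ i, PowerSeries.coeff (r i) toddSeries

/-- The `N`-th Todd polynomial in `n` variables: the homogeneous part of total degree `N` of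
the Todd power series in `n` variables. -/
noncomputable def toddPolynomial (N n : ℕ) : MvPolynomial (Fin n) ℚ :=
  ∑ r ∈ Finset.finsuppAntidiag (Finset.univ : Finset (Fin n)) N,
    MvPolynomial.monomial r (MvPowerSeries.coeff r (toddSeriesMv n))

/-- `d_{N,n}`: the least common multiple of the denominators of the coefficients of the `N`-th
Todd polynomial in `n` variables. -/
noncomputable def toddDenominator (N n : ℕ) : ℕ :=
  (toddPolynomial N n).support.lcm fun r => ((toddPolynomial N n).coeff r).den

/-- `B_m / m! = ∏ i, B_{m_i} / m_i!` for a multi-index `m`. -/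
noncomputable def bernoulliQuotient {n : ℕ} (m : Fin n → ℕ) : ℚ :=
  ∏ i, bernoulli (m i) / ((m i).factorial : ℚ)

/-- The integer `d_{N,n} · B_m / m!` for a multi-index `m` with `∑ i, m_i = N`; see
`coe_scaledCoeff`: the rational number is an integer, so that taking its numerator
loses nothing. -/
noncomputable def scaledCoeff (N : ℕ) {n : ℕ} (m : Fin n → ℕ) : ℤ :=
  ((toddDenominator N n : ℚ) * bernoulliQuotient m).num

theorem coeff_toddPolynomial {N n : ℕ} (r : Fin n →₀ ℕ) (hr : ∑ i, r i = N) :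
    (toddPolynomial N n).coeff r = (-1) ^ N * bernoulliQuotient (fun i => r i) := by
  have hmem : r ∈ Finset.finsuppAntidiag (Finset.univ : Finset (Fin n)) N := by
    simp [Finset.mem_finsuppAntidiag, hr]
  rw [toddPolynomial, MvPolynomial.coeff_sum, Finset.sum_eq_single r]
  · rw [MvPolynomial.coeff_monomial, if_pos rfl]
    change ∏ i, PowerSeries.coeff (r i) toddSeries = _
    simp only [toddSeries, PowerSeries.coeff_mk, bernoulliQuotient]
    rw [Finset.prod_mul_distrib, Finset.prod_pow_eq_pow_sum, hr]
  · intro b _ hb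
    rw [MvPolynomial.coeff_monomial, if_neg hb]
  · intro h
    exact absurd hmem h

theorem coe_scaledCoeff {N n : ℕ} (m : Fin n → ℕ) (hm : ∑ i, m i = N) :
    (scaledCoeff N m : ℚ) = (toddDenominator N n : ℚ) * bernoulliQuotient m := by
  suffices h : ∃ c : ℤ, (c : ℚ) = (toddDenominator N n : ℚ) * bernoulliQuotient m by
    obtain ⟨c, hc⟩ := h
    rw [scaledCoeff, ← hc, Rat.num_intCast]
  set r : Fin n →₀ ℕ := Finsupp.equivFunOnFinite.symm m with hr
  have hco := coeff_toddPolynomial (N := N) r (by simpa [hr] using hm)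
  have hb : bernoulliQuotient m = (-1) ^ N * (toddPolynomial N n).coeff r := by
    rw [hco, ← mul_assoc, ← mul_pow]
    simp [hr]
  by_cases h0 : (toddPolynomial N n).coeff r = 0
  · exact ⟨0, by rw [hb, h0]; simp⟩
  · have hdvd : ((toddPolynomial N n).coeff r).den ∣ toddDenominator N n :=
      Finset.dvd_lcm (f := fun r => ((toddPolynomial N n).coeff r).den)
        (MvPolynomial.mem_support_iff.2 h0)
    obtain ⟨k, hk⟩ := hdvd
    refine ⟨(-1) ^ N * (k * ((toddPolynomial N n).coeff r).num), ?_⟩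
    rw [hb, hk]
    push_cast
    have := Rat.mul_den_eq_num ((toddPolynomial N n).coeff r)
    rw [← this]
    ring

/-- The cotangent sum
`∑_{k=1}^{q-1} cot (π k / q) cot (π p_1 k / q) ⋯ cot (π p_{n-1} k / q)`. -/
noncomputable def cotSum {n : ℕ} (q : ℕ) (p : Fin (n - 1) → ℤ) : ℝ :=
  ∑ k ∈ Finset.Ico 1 q,
    Real.cot (Real.pi * k / q) * ∏ i, Real.cot (Real.pi * p i * k / q)

/-- Zagier's higher dimensional Dedekind sum (for even `n`): `(-1)^{n/2}` times the
cotangent sum. -/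
noncomputable def zagierSum {n : ℕ} (q : ℕ) (p : Fin (n - 1) → ℤ) : ℝ :=
  (-1) ^ (n / 2) * cotSum (n := n) q p

/-- The multi-indices `m = (m_1, …, m_n)` of non-negative even integers with sum `n`. -/
def evenIndices (n : ℕ) : Finset (Fin n → ℕ) :=
  (Finset.piAntidiag Finset.univ n).filter fun m => ∀ i, Even (m i)

/-- The residue class modulo `q` of `∑_m d_{n,n} (B_m / m!) ∏_{i<n} p_i^{m_i - 1}`, where `m`
runs over `evenIndices n` and the powers (with exponent `-1` if `m_i = 0`) are those of the
unit `p_i` of `ℤ/q`. -/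
noncomputable def residueSum {n : ℕ} (q : ℕ) (p : Fin (n - 1) → ℤ)
    (hp : ∀ i, IsCoprime (p i) (q : ℤ)) : ZMod q :=
  ∑ m ∈ evenIndices n, (scaledCoeff n m : ZMod q) *
    ∏ i : Fin (n - 1),
      ((ZMod.unitOfIsCoprime (p i) (hp i) ^ ((m (Fin.castLE (Nat.sub_le n 1) i) : ℤ) - 1) :
        (ZMod q)ˣ) : ZMod q)

end DedekindZagier

namespace DedekindZagier

/-! Write T(s) = s/(e^s - 1). With y running over the q-th roots of unity other than 1, the Zagier
sum is ∑ ∏_j (y^{P_j} + 1)/(y^{P_j} - 1), where the P_j are natural representatives of the p_j and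
the last one is 1. If P_j a_j ≡ 1 mod q then y = (y^{P_j})^{a_j}, so every factor acquires the
denominator y - 1 and the sum becomes ∑ G(y)/(y - 1)^n with G an integer polynomial.

The residue theorem for G(y)/(y - 1)^n · q/(y^q - 1) · dy/y suggests that this sum is minus the
degree n coefficient of G(e^s) T(s)^n T(qs), up to residues at 0 and ∞. That error is q times an
integer (`exists_rootSumDefect_eq`), proved algebraically by induction on n.

It remains to reduce the coefficient mod q. All series lie in a ring whose degree k coefficients are
integral combinations of products ∏ B_{m_i}/m_i! of weight k, and d clears these in weight n. In
this ring T(P_j a_j s) ≡ T(s) and T(qs) ≡ 1 mod q, so d/2^n times the coefficient is ∏ a_j times d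
times the degree n coefficient of ∏ (P_j s/2) coth(P_j s/2), mod q (`coeff_cotPolynomial_exp`).
Expanding gives the sum over even m. -/

/-! ### Sums over roots of unity and the residue at 1 -/

open PowerSeries in
theorem X_mul_derivative_bernoulliPowerSeries_pow (n : ℕ) :
    X * d⁄dX ℚ (bernoulliPowerSeries ℚ ^ n) =
      (n : ℚ⟦X⟧) * (bernoulliPowerSeries ℚ ^ n - exp ℚ * bernoulliPowerSeries ℚ ^ (n + 1)) := by
  have h := bernoulliPowerSeries_mul_exp_sub_one ℚ
  have hd := congrArg (d⁄dX ℚ) h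
  simp only [Derivation.leibniz, smul_eq_mul, map_sub, derivative_exp, derivative_X,
    Derivation.map_one_eq_zero, sub_zero] at hd
  set T := bernoulliPowerSeries ℚ
  have key : X * d⁄dX ℚ T = T - exp ℚ * T ^ 2 := by
    linear_combination T * hd - d⁄dX ℚ T * h
  rcases n with _ | n
  · simp
  · rw [Derivation.leibniz_pow]
    simp only [smul_eq_mul, nsmul_eq_mul, Nat.add_sub_cancel]
    linear_combination (((n + 1 : ℕ) : ℚ⟦X⟧) * T ^ n) * key

/-- With w = e^s - 1 this is the residue of w^{-n-1} dw. Formally, X · d/dX multiplies a degree n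
coefficient by n, so the preceding identity leaves n times this coefficient equal to 0. -/
theorem coeff_exp_mul_bernoulliPowerSeries_pow {n : ℕ} (hn : n ≠ 0) :
    PowerSeries.coeff n (PowerSeries.exp ℚ * bernoulliPowerSeries ℚ ^ (n + 1)) = 0 := by
  have h := congrArg (PowerSeries.coeff n) (X_mul_derivative_bernoulliPowerSeries_pow n)
  obtain ⟨m, rfl⟩ := Nat.exists_eq_succ_of_ne_zero hn
  rw [Nat.succ_eq_add_one, PowerSeries.coeff_succ_X_mul, PowerSeries.coeff_derivative,
    ← map_natCast (PowerSeries.C (R := ℚ)), PowerSeries.coeff_C_mul, map_sub] at h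
  have hm : ((m + 1 : ℕ) : ℚ) ≠ 0 := by positivity
  push_cast at h hm
  have : ((m : ℚ) + 1) * PowerSeries.coeff (m + 1)
      (PowerSeries.exp ℚ * bernoulliPowerSeries ℚ ^ (m + 1 + 1)) = 0 := by
    linear_combination h
  exact (mul_eq_zero.1 this).resolve_left hm

/-- The sum of `G ζ / (ζ - 1) ^ n` over the nontrivial `q`-th roots of unity, minus its value as
predicted by the residue at `1`. -/
noncomputable def rootSumDefect (q n : ℕ) (ζ : ℂ) : Polynomial ℤ →+ ℂ :=
  AddMonoidHom.mk' (fun G => ∑ k ∈ Finset.Ico 1 q, Polynomial.aeval (ζ ^ k) G / (ζ ^ k - 1) ^ n +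
    ((PowerSeries.coeff n (Polynomial.aeval (PowerSeries.exp ℚ) G * bernoulliPowerSeries ℚ ^ n *
      PowerSeries.rescale (q : ℚ) (bernoulliPowerSeries ℚ)) : ℚ) : ℂ)) fun G H => by
    simp only [map_add, add_mul, add_div, Finset.sum_add_distrib, Rat.cast_add]
    ring

theorem rootSumDefect_apply (q n : ℕ) (ζ : ℂ) (G : Polynomial ℤ) :
    rootSumDefect q n ζ G =
      ∑ k ∈ Finset.Ico 1 q, Polynomial.aeval (ζ ^ k) G / (ζ ^ k - 1) ^ n +
      ((PowerSeries.coeff n (Polynomial.aeval (PowerSeries.exp ℚ) G * bernoulliPowerSeries ℚ ^ n *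
        PowerSeries.rescale (q : ℚ) (bernoulliPowerSeries ℚ)) : ℚ) : ℂ) := rfl

theorem pow_ne_one_of_mem_Ico {q : ℕ} {ζ : ℂ} (hζ : IsPrimitiveRoot ζ q) {k : ℕ}
    (hk : k ∈ Finset.Ico 1 q) : ζ ^ k ≠ 1 := by
  rw [Finset.mem_Ico] at hk
  exact hζ.pow_ne_one_of_pos_of_lt (by omega) hk.2

/-- A factor y - 1 cancels in each term of the sum, while (e^s - 1) T(s) = s shifts the degree of
the series by one. -/
theorem rootSumDefect_succ {q : ℕ} {ζ : ℂ} (hζ : IsPrimitiveRoot ζ q) (n : ℕ)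
    (G : Polynomial ℤ) :
    rootSumDefect q (n + 1) ζ ((Polynomial.X - 1) * G) = rootSumDefect q n ζ G := by
  rw [rootSumDefect_apply, rootSumDefect_apply]
  congr 1
  · refine Finset.sum_congr rfl fun k hk => ?_
    have h := sub_ne_zero.2 (pow_ne_one_of_mem_Ico hζ hk)
    simp only [map_mul, map_sub, Polynomial.aeval_X, map_one, pow_succ']
    rw [mul_div_mul_left _ _ h]
  · have h : Polynomial.aeval (PowerSeries.exp ℚ) ((Polynomial.X - 1) * G) *
        bernoulliPowerSeries ℚ ^ (n + 1) * PowerSeries.rescale (q : ℚ) (bernoulliPowerSeries ℚ) =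
        PowerSeries.X * (Polynomial.aeval (PowerSeries.exp ℚ) G * bernoulliPowerSeries ℚ ^ n *
          PowerSeries.rescale (q : ℚ) (bernoulliPowerSeries ℚ)) := by
      rw [← bernoulliPowerSeries_mul_exp_sub_one ℚ]
      simp only [map_mul, map_sub, Polynomial.aeval_X, map_one]
      ring
    rw [h, PowerSeries.coeff_succ_X_mul]

theorem constantCoeff_bernoulliPowerSeries :
    PowerSeries.constantCoeff (bernoulliPowerSeries ℚ) = 1 := by
  rw [← PowerSeries.coeff_zero_eq_constantCoeff_apply]
  simp [bernoulliPowerSeries]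

theorem rootSumDefect_zero {q : ℕ} (hq : 0 < q) (ζ : ℂ) (G : Polynomial ℤ) :
    rootSumDefect q 0 ζ G = ∑ k ∈ Finset.range q, Polynomial.aeval (ζ ^ k) G := by
  rw [Finset.range_eq_Ico, Finset.sum_eq_sum_Ico_succ_bot hq, rootSumDefect_apply, add_comm]
  congr 1
  · simp only [pow_zero, mul_one, PowerSeries.coeff_zero_eq_constantCoeff_apply, map_mul]
    have h1 : PowerSeries.constantCoeff (PowerSeries.rescale (q : ℚ) (bernoulliPowerSeries ℚ)) = 1 := by
      rw [← PowerSeries.coeff_zero_eq_constantCoeff_apply, PowerSeries.coeff_rescale, pow_zero,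
        one_mul, PowerSeries.coeff_zero_eq_constantCoeff_apply, constantCoeff_bernoulliPowerSeries]
    rw [h1, mul_one, Polynomial.aeval_def, Polynomial.hom_eval₂, Polynomial.aeval_def]
    have h2 := Polynomial.hom_eval₂ G ((PowerSeries.constantCoeff (R := ℚ)).comp
      (algebraMap ℤ (PowerSeries ℚ))) (Rat.castHom ℂ) (PowerSeries.constantCoeff (PowerSeries.exp ℚ))
    rw [Rat.coe_castHom] at h2
    rw [h2]
    congr 1
    simp
  · simp

theorem sum_pow_pow_eq_zero {q : ℕ} {ζ : ℂ} (hζ : IsPrimitiveRoot ζ q) {a : ℕ} (ha : ¬ q ∣ a) :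
    ∑ k ∈ Finset.range q, (ζ ^ k) ^ a = 0 := by
  have h1 : ζ ^ a ≠ 1 := fun h => ha (hζ.dvd_of_pow_eq_one a h)
  have h2 : (ζ ^ a) ^ q = 1 := by rw [← pow_mul, mul_comm, pow_mul, hζ.pow_eq_one, one_pow]
  calc ∑ k ∈ Finset.range q, (ζ ^ k) ^ a = ∑ k ∈ Finset.range q, (ζ ^ a) ^ k :=
        Finset.sum_congr rfl fun k _ => by rw [← pow_mul, mul_comm, pow_mul]
    _ = 0 := by rw [geom_sum_eq h1, h2, sub_self, zero_div]

theorem exists_sum_aeval_eq {q : ℕ} {ζ : ℂ} (hζ : IsPrimitiveRoot ζ q) (G : Polynomial ℤ) :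
    ∃ z : ℤ, ∑ k ∈ Finset.range q, Polynomial.aeval (ζ ^ k) G = q * z := by
  induction G using Polynomial.induction_on' with
  | add G H hG hH =>
    obtain ⟨x, hx⟩ := hG
    obtain ⟨y, hy⟩ := hH
    exact ⟨x + y, by simp only [map_add, Finset.sum_add_distrib, hx, hy]; push_cast; ring⟩
  | monomial a c =>
    simp only [Polynomial.aeval_monomial, ← Finset.mul_sum]
    by_cases ha : q ∣ a
    · refine ⟨c, ?_⟩
      have : ∀ k ∈ Finset.range q, (ζ ^ k) ^ a = 1 := fun k _ => by
        obtain ⟨b, rfl⟩ := ha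
        rw [← pow_mul, mul_left_comm, pow_mul, hζ.pow_eq_one, one_pow]
      rw [Finset.sum_congr rfl this]
      simp [mul_comm]
    · exact ⟨0, by simp [sum_pow_pow_eq_zero hζ ha]⟩

theorem rescale_bernoulliPowerSeries_mul (c : ℕ) :
    PowerSeries.rescale (c : ℚ) (bernoulliPowerSeries ℚ) * (PowerSeries.exp ℚ ^ c - 1) =
      (c : PowerSeries ℚ) * PowerSeries.X := by
  have h := congrArg (PowerSeries.rescale (c : ℚ)) (bernoulliPowerSeries_mul_exp_sub_one ℚ)
  rw [map_mul, map_sub, map_one, ← PowerSeries.exp_pow_eq_rescale_exp, PowerSeries.rescale_X] at h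
  simpa using h

/-- For y ≠ 1 the powers y, ..., y^q sum to 0. On the series side the geometric sum cancels T(qs),
leaving q e^s T^{n+1}. -/
theorem sum_rootSumDefect_X_pow {q : ℕ} {ζ : ℂ} (hζ : IsPrimitiveRoot ζ q) {n : ℕ} (hn : n ≠ 0) :
    ∑ a ∈ Finset.range q, rootSumDefect q n ζ (Polynomial.X ^ (a + 1)) = 0 := by
  rw [← map_sum, rootSumDefect_apply]
  have h1 : ∀ k ∈ Finset.Ico 1 q, Polynomial.aeval (ζ ^ k)
      (∑ a ∈ Finset.range q, (Polynomial.X : Polynomial ℤ) ^ (a + 1)) / (ζ ^ k - 1) ^ n = 0 := by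
    intro k hk
    have h2 : (ζ ^ k) ^ q = 1 := by rw [← pow_mul, mul_comm, pow_mul, hζ.pow_eq_one, one_pow]
    simp only [map_sum, map_pow, Polynomial.aeval_X]
    simp only [pow_succ, ← Finset.sum_mul]
    rw [geom_sum_eq (pow_ne_one_of_mem_Ico hζ hk), h2, sub_self, zero_div, zero_mul, zero_div]
  have h2 : Polynomial.aeval (PowerSeries.exp ℚ)
      (∑ a ∈ Finset.range q, (Polynomial.X : Polynomial ℤ) ^ (a + 1)) *
      bernoulliPowerSeries ℚ ^ n * PowerSeries.rescale (q : ℚ) (bernoulliPowerSeries ℚ) =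
      PowerSeries.C (q : ℚ) * (PowerSeries.exp ℚ * bernoulliPowerSeries ℚ ^ (n + 1)) := by
    simp only [map_sum, map_pow, Polynomial.aeval_X, map_natCast]
    simp only [pow_succ (PowerSeries.exp ℚ), ← Finset.sum_mul]
    have hT := bernoulliPowerSeries_mul_exp_sub_one ℚ
    have hg := geom_sum_mul (PowerSeries.exp ℚ) q
    have hq := rescale_bernoulliPowerSeries_mul q
    refine mul_left_cancel₀ (PowerSeries.X_ne_zero (R := ℚ)) ?_
    set T := bernoulliPowerSeries ℚ
    set e := PowerSeries.exp ℚ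
    set g := ∑ a ∈ Finset.range q, e ^ a
    set Tq := PowerSeries.rescale (q : ℚ) T
    linear_combination (T * e * T ^ n) * hq + (T * e * T ^ n * Tq) * hg - (g * e * T ^ n * Tq) * hT
  rw [Finset.sum_eq_zero h1, h2, PowerSeries.coeff_C_mul, coeff_exp_mul_bernoulliPowerSeries_pow hn]
  simp

/-- For exponents 1, ..., q the differential form has no residue at 0 or ∞. Algebraically,
consecutive differences are defects of the previous level, hence 0 by induction; the q defects are
thus equal, and they sum to 0. -/
theorem rootSumDefect_X_pow {q : ℕ} (hq : 0 < q) {ζ : ℂ} (hζ : IsPrimitiveRoot ζ q) (n : ℕ) :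
    ∀ a < q, rootSumDefect q (n + 1) ζ (Polynomial.X ^ (a + 1)) = 0 := by
  have step : ∀ n, (∀ a, a + 1 < q → rootSumDefect q n ζ (Polynomial.X ^ (a + 1)) = 0) →
      ∀ a < q, rootSumDefect q (n + 1) ζ (Polynomial.X ^ (a + 1)) = 0 := by
    intro n h
    have hc : ∀ a < q, rootSumDefect q (n + 1) ζ (Polynomial.X ^ (a + 1)) =
        rootSumDefect q (n + 1) ζ (Polynomial.X ^ 1) := by
      intro a
      induction a with
      | zero => intro _; rfl
      | succ a ih =>
        intro ha
        have h1 := rootSumDefect_succ hζ n (Polynomial.X ^ (a + 1))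
        rw [h a ha, sub_mul, one_mul, map_sub, ← pow_succ', sub_eq_zero] at h1
        rw [h1, ih (by omega)]
    have hs := sum_rootSumDefect_X_pow hζ (Nat.succ_ne_zero n)
    rw [Nat.succ_eq_add_one, Finset.sum_congr rfl fun a ha => hc a (Finset.mem_range.1 ha)] at hs
    rw [Finset.sum_const, Finset.card_range, nsmul_eq_mul, mul_eq_zero] at hs
    have h0 := hs.resolve_left (by exact_mod_cast hq.ne')
    intro a ha
    rw [hc a ha, h0]
  induction n with
  | zero =>
    refine step 0 fun a ha => ?_
    rw [rootSumDefect_zero hq]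
    simp only [map_pow, Polynomial.aeval_X]
    exact sum_pow_pow_eq_zero hζ (Nat.not_dvd_of_pos_of_lt (by omega) ha)
  | succ n ih => exact step (n + 1) fun a ha => ih a (by omega)

/-- The defect is a multiple of `q`. -/
theorem exists_rootSumDefect_eq {q : ℕ} (hq : 0 < q) {ζ : ℂ} (hζ : IsPrimitiveRoot ζ q) (n : ℕ) :
    ∀ G : Polynomial ℤ, ∃ z : ℤ, rootSumDefect q n ζ G = q * z := by
  induction n with
  | zero =>
    intro G
    rw [rootSumDefect_zero hq]
    exact exists_sum_aeval_eq hζ G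
  | succ n ih =>
    intro G
    -- Subtracting G(1) X rather than G(1): the defect of X vanishes, that of 1 need not.
    have hr : (Polynomial.X - Polynomial.C 1) ∣
        G - Polynomial.C (G.eval 1) * Polynomial.X := by
      rw [Polynomial.dvd_iff_isRoot]
      simp [Polynomial.IsRoot]
    obtain ⟨H, hH⟩ := hr
    obtain ⟨z, hz⟩ := ih H
    refine ⟨z, ?_⟩
    have hG : G = G.eval 1 • Polynomial.X ^ (0 + 1) + (Polynomial.X - 1) * H := by
      rw [Polynomial.C_1] at hH
      rw [← hH, zero_add, pow_one, Polynomial.smul_eq_C_mul]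
      ring
    rw [hG, map_add, map_zsmul, rootSumDefect_X_pow hq hζ n 0 hq, rootSumDefect_succ hζ, hz]
    simp

/-! ### Integrality of Bernoulli products and congruences mod q -/

/-- The additive group generated by the products `∏ B_{m_i} / m_i!` with `∑ m_i = k`. -/
def bernoulliLattice (k : ℕ) : AddSubgroup ℚ :=
  AddSubgroup.closure {x | ∃ l : Multiset ℕ, l.sum = k ∧
    (l.map fun m => bernoulli m / (m.factorial : ℚ)).prod = x}

theorem one_mem_bernoulliLattice : (1 : ℚ) ∈ bernoulliLattice 0 :=
  AddSubgroup.subset_closure ⟨0, by simp, by simp⟩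

theorem mul_mem_bernoulliLattice {a b : ℕ} {x y : ℚ} (hx : x ∈ bernoulliLattice a)
    (hy : y ∈ bernoulliLattice b) : x * y ∈ bernoulliLattice (a + b) := by
  induction hx using AddSubgroup.closure_induction with
  | zero => simp [zero_mem]
  | add x x' _ _ h h' => exact add_mul x x' y ▸ add_mem h h'
  | neg x _ h => exact neg_mul x y ▸ neg_mem h
  | mem x hx =>
    induction hy using AddSubgroup.closure_induction with
    | zero => simp [zero_mem]
    | add y y' _ _ h h' => exact mul_add x y y' ▸ add_mem h h'
    | neg y _ h => exact mul_neg x y ▸ neg_mem h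
    | mem y hy =>
      obtain ⟨l, rfl, rfl⟩ := hx
      obtain ⟨l', rfl, rfl⟩ := hy
      exact AddSubgroup.subset_closure ⟨l + l', by simp, by simp⟩

/-- The power series whose coefficient of degree `k` lies in `bernoulliLattice k`. -/
def bernoulliSubring : Subring (PowerSeries ℚ) where
  carrier := {f | ∀ k, PowerSeries.coeff k f ∈ bernoulliLattice k}
  zero_mem' k := by simp [zero_mem]
  one_mem' k := by
    rw [PowerSeries.coeff_one]
    split_ifs with h
    · exact h ▸ one_mem_bernoulliLattice
    · exact zero_mem _
  add_mem' hf hg k := by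
    rw [map_add]
    exact add_mem (hf k) (hg k)
  neg_mem' hf k := by
    rw [map_neg]
    exact neg_mem (hf k)
  mul_mem' hf hg k := by
    rw [PowerSeries.coeff_mul]
    refine sum_mem fun x hx => ?_
    rw [← Finset.HasAntidiagonal.mem_antidiagonal.1 hx]
    exact mul_mem_bernoulliLattice (hf _) (hg _)

/-- With constant term 1, the recursion for the inverse involves no division. -/
theorem inv_mem_bernoulliSubring {f : PowerSeries ℚ} (hf : f ∈ bernoulliSubring)
    (h1 : PowerSeries.constantCoeff f = 1) : f⁻¹ ∈ bernoulliSubring := by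
  intro k
  induction k using Nat.strong_induction_on with
  | _ k ih =>
    rw [PowerSeries.coeff_inv, h1, inv_one]
    split_ifs with hk
    · exact hk ▸ one_mem_bernoulliLattice
    · rw [neg_one_mul]
      refine neg_mem (sum_mem fun x hx => ?_)
      split_ifs with hlt
      · rw [← Finset.HasAntidiagonal.mem_antidiagonal.1 hx]
        exact mul_mem_bernoulliLattice (hf _) (ih _ hlt)
      · exact zero_mem _

theorem bernoulli_div_factorial_mem (k : ℕ) :
    bernoulli k / (k.factorial : ℚ) ∈ bernoulliLattice k :=
  AddSubgroup.subset_closure ⟨{k}, by simp, by simp⟩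

theorem coeff_bernoulliPowerSeries (k : ℕ) :
    PowerSeries.coeff k (bernoulliPowerSeries ℚ) = bernoulli k / (k.factorial : ℚ) := by
  simp [bernoulliPowerSeries]

theorem rescale_bernoulliPowerSeries_mem (c : ℕ) :
    PowerSeries.rescale (c : ℚ) (bernoulliPowerSeries ℚ) ∈ bernoulliSubring := by
  intro k
  rw [PowerSeries.coeff_rescale, coeff_bernoulliPowerSeries, ← Nat.cast_pow, ← nsmul_eq_mul]
  exact nsmul_mem (bernoulli_div_factorial_mem k) _

theorem constantCoeff_rescale_bernoulliPowerSeries (c : ℚ) :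
    PowerSeries.constantCoeff (PowerSeries.rescale c (bernoulliPowerSeries ℚ)) = 1 := by
  rw [← PowerSeries.coeff_zero_eq_constantCoeff_apply, PowerSeries.coeff_rescale, pow_zero,
    one_mul, PowerSeries.coeff_zero_eq_constantCoeff_apply, constantCoeff_bernoulliPowerSeries]

/-- The degree k coefficients differ by (a^k - b^k) B_k/k!, and q divides a^k - b^k. -/
theorem rescale_bernoulliPowerSeries_congr {q a b : ℕ} (h : a ≡ b [MOD q]) :
    ∃ g ∈ bernoulliSubring, PowerSeries.rescale (a : ℚ) (bernoulliPowerSeries ℚ) =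
      PowerSeries.rescale (b : ℚ) (bernoulliPowerSeries ℚ) + (q : PowerSeries ℚ) * g := by
  have hz : ∀ k : ℕ, ∃ z : ℤ, (a : ℤ) ^ k = (b : ℤ) ^ k + q * z := fun k => by
    obtain ⟨z, hz⟩ := (Nat.modEq_iff_dvd.1 (h.symm.pow k))
    exact ⟨z, by push_cast at hz; linear_combination hz⟩
  choose z hz using hz
  refine ⟨PowerSeries.mk fun k => z k • (bernoulli k / (k.factorial : ℚ)), fun k => ?_, ?_⟩
  · rw [PowerSeries.coeff_mk]
    exact zsmul_mem (bernoulli_div_factorial_mem k) _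
  · ext k
    have hk : (a : ℚ) ^ k = (b : ℚ) ^ k + q * z k := by exact_mod_cast hz k
    rw [map_add, ← map_natCast (PowerSeries.C (R := ℚ)), PowerSeries.coeff_C_mul,
      PowerSeries.coeff_mk, PowerSeries.coeff_rescale, PowerSeries.coeff_rescale,
      coeff_bernoulliPowerSeries, hk, zsmul_eq_mul]
    ring

theorem prod_eq_one_add_mul {R ι : Type*} [CommRing R] (S : Subring R) (q : ℕ) (s : Finset ι)
    (f : ι → R) (hf : ∀ i ∈ s, ∃ g ∈ S, f i = 1 + q * g) :
    ∃ g ∈ S, ∏ i ∈ s, f i = 1 + q * g := by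
  refine Finset.prod_induction f (fun x => ∃ g ∈ S, x = 1 + q * g) ?_ ⟨0, zero_mem _, by simp⟩ hf
  rintro _ _ ⟨g, hg, rfl⟩ ⟨h, hh, rfl⟩
  exact ⟨g + h + q * (g * h), add_mem (add_mem hg hh) (mul_mem (natCast_mem _ _) (mul_mem hg hh)),
    by ring⟩

/-- Since B_0/0! = 1, zeros can be dropped or added freely, and at most n entries of a list of sum n
are nonzero; so every such product is one indexed by an n-tuple. -/
theorem toddDenominator_mul_prod (l : Multiset ℕ) :
    ∃ z : ℤ, (toddDenominator l.sum l.sum : ℚ) *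
      (l.map fun m => bernoulli m / (m.factorial : ℚ)).prod = z := by
  classical
  set n := l.sum with hn
  have hcard : (l.filter (· ≠ 0)).card ≤ n := by
    rw [hn, ← Multiset.filter_add_not (· ≠ 0) l, Multiset.sum_add]
    refine le_trans ?_ (Nat.le_add_right _ _)
    have := Multiset.card_nsmul_le_sum (s := l.filter (· ≠ 0)) (a := 1) fun x hx =>
      Nat.one_le_iff_ne_zero.2 (Multiset.mem_filter.1 hx).2
    simpa [Multiset.filter_filter] using this
  have hzero : l.filter (fun x => ¬ x ≠ 0) =
      Multiset.replicate (l.filter (fun x => ¬ x ≠ 0)).card 0 :=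
    Multiset.eq_replicate_card.2 fun x hx => by simpa using (Multiset.mem_filter.1 hx).2
  set l' := l.filter (· ≠ 0) + Multiset.replicate (n - (l.filter (· ≠ 0)).card) 0 with hl'
  have hc : l'.toList.length = n := by
    rw [Multiset.length_toList, hl', Multiset.card_add, Multiset.card_replicate]
    omega
  have hsum : l'.sum = n := by
    rw [hn, ← Multiset.filter_add_not (· ≠ 0) l, hzero, hl']
    simp
  have hprod : (l'.map fun m => bernoulli m / (m.factorial : ℚ)).prod =
      (l.map fun m => bernoulli m / (m.factorial : ℚ)).prod := by
    conv_rhs => rw [← Multiset.filter_add_not (· ≠ 0) l, hzero]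
    rw [hl']
    simp
  have hmap : Multiset.map (fun i : Fin n => l'.toList.get (i.cast hc.symm)) Finset.univ.val = l' := by
    conv_rhs => rw [← Multiset.coe_toList l', ← List.ofFn_get l'.toList]
    rw [List.ofFn_congr hc]
    simp [Fin.univ_def, List.ofFn_eq_map]
  have hs : ∑ i : Fin n, l'.toList.get (i.cast hc.symm) = n := by
    rw [Finset.sum_eq_multiset_sum, hmap, hsum]
  refine ⟨scaledCoeff n fun i : Fin n => l'.toList.get (i.cast hc.symm), ?_⟩
  rw [coe_scaledCoeff _ hs, bernoulliQuotient, ← hprod, Finset.prod_eq_multiset_prod]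
  conv_lhs => rw [← hmap, Multiset.map_map]
  rfl

theorem toddDenominator_mul_mem {n : ℕ} {x : ℚ} (hx : x ∈ bernoulliLattice n) :
    ∃ z : ℤ, (toddDenominator n n : ℚ) * x = z := by
  induction hx using AddSubgroup.closure_induction with
  | mem x hx =>
    obtain ⟨l, rfl, rfl⟩ := hx
    exact toddDenominator_mul_prod l
  | zero => exact ⟨0, by simp⟩
  | add x y _ _ hx hy =>
    obtain ⟨a, ha⟩ := hx
    obtain ⟨b, hb⟩ := hy
    exact ⟨a + b, by rw [mul_add, ha, hb]; push_cast; rfl⟩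
  | neg x _ hx =>
    obtain ⟨a, ha⟩ := hx
    exact ⟨-a, by rw [mul_neg, ha]; push_cast; rfl⟩

/-- (B_1/1!)^n = (-1/2)^n is among the products cleared by d. -/
theorem exists_toddDenominator_eq (n : ℕ) : ∃ D : ℤ, (toddDenominator n n : ℚ) = 2 ^ n * D := by
  have h : ((-1 / 2) ^ n : ℚ) ∈ bernoulliLattice n :=
    AddSubgroup.subset_closure ⟨Multiset.replicate n 1, by simp, by simp [bernoulli_one]⟩
  obtain ⟨z, hz⟩ := toddDenominator_mul_mem h
  refine ⟨(-1) ^ n * z, ?_⟩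
  push_cast
  rw [← hz, div_pow]
  have h2 : ((-1 : ℚ) ^ n) * (-1) ^ n = 1 := by rw [← mul_pow]; simp
  field_simp
  linear_combination (-(toddDenominator n n : ℚ)) * h2

/-! ### Expansion of the cotangent factors at 1 -/

/-- The even series `(s / 2) coth (s / 2)`. -/
noncomputable def evenBernoulliSeries : PowerSeries ℚ :=
  bernoulliPowerSeries ℚ + PowerSeries.C (1 / 2 : ℚ) * PowerSeries.X

theorem coeff_evenBernoulliSeries (k : ℕ) : PowerSeries.coeff k evenBernoulliSeries =
    if Even k then bernoulli k / (k.factorial : ℚ) else 0 := by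
  rw [evenBernoulliSeries, map_add, coeff_bernoulliPowerSeries, PowerSeries.coeff_C_mul,
    PowerSeries.coeff_X]
  by_cases h1 : k = 1
  · subst h1
    norm_num
  · rw [if_neg h1, mul_zero, add_zero]
    split_ifs with hk
    · rfl
    · have hodd := Nat.not_even_iff_odd.1 hk
      have : 1 < k := by
        rcases hodd with ⟨j, rfl⟩
        omega
      rw [bernoulli_eq_zero_of_odd hodd this, zero_div]

theorem rescale_evenBernoulliSeries_mem (c : ℕ) :
    PowerSeries.rescale (c : ℚ) evenBernoulliSeries ∈ bernoulliSubring := by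
  intro k
  rw [PowerSeries.coeff_rescale, coeff_evenBernoulliSeries, ← Nat.cast_pow, ← nsmul_eq_mul]
  refine nsmul_mem ?_ _
  split_ifs
  · exact bernoulli_div_factorial_mem k
  · exact zero_mem _

theorem exp_pow_sub_one_ne_zero {c : ℕ} (hc : c ≠ 0) : PowerSeries.exp ℚ ^ c - 1 ≠ 0 := by
  intro h
  have h1 := rescale_bernoulliPowerSeries_mul c
  rw [h, mul_zero] at h1
  have h2 := congrArg (PowerSeries.coeff 1) h1
  rw [← map_natCast (PowerSeries.C (R := ℚ)), PowerSeries.coeff_C_mul,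
    PowerSeries.coeff_one_X, mul_one, map_zero] at h2
  exact hc (by exact_mod_cast h2.symm)

/-- The `s`-expansion of a factor `(y ^ p + 1) (y ^ (p * a) - 1) / (y ^ p - 1) / (y - 1)`. -/
theorem geom_sum_exp_mul {q p a : ℕ} (hp : p ≠ 0) (h : p * a ≡ 1 [MOD q]) :
    ∃ u : PowerSeries ℚ, (∃ g ∈ bernoulliSubring, u = 1 + q * g) ∧
      (∑ i ∈ Finset.range a, (PowerSeries.exp ℚ ^ p) ^ i) * (PowerSeries.exp ℚ ^ p + 1) *
        bernoulliPowerSeries ℚ =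
      PowerSeries.C (2 * a : ℚ) * (PowerSeries.rescale (p : ℚ) evenBernoulliSeries * u) := by
  obtain ⟨g, hg, hgq⟩ := rescale_bernoulliPowerSeries_congr h
  rw [Nat.cast_one, PowerSeries.rescale_one, RingHom.id_apply] at hgq
  have hT := rescale_bernoulliPowerSeries_mul (p * a)
  have hTp := rescale_bernoulliPowerSeries_mul p
  have hE : PowerSeries.rescale (p : ℚ) evenBernoulliSeries =
      PowerSeries.rescale (p : ℚ) (bernoulliPowerSeries ℚ) +
        PowerSeries.C (1 / 2 : ℚ) * ((p : PowerSeries ℚ) * PowerSeries.X) := by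
    rw [evenBernoulliSeries, map_add, map_mul, PowerSeries.rescale_X, map_natCast]
    congr 2
    ext k
    rw [PowerSeries.coeff_rescale, PowerSeries.coeff_C]
    split_ifs with hk
    · simp [hk]
    · simp
  have h2 : PowerSeries.C (2 * a : ℚ) * PowerSeries.C (1 / 2 : ℚ) = (a : PowerSeries ℚ) := by
    rw [← map_mul, ← map_natCast (PowerSeries.C (R := ℚ))]
    congr 1
    ring
  have h3 : PowerSeries.C (2 * a : ℚ) = 2 * (a : PowerSeries ℚ) := by
    rw [map_mul, map_natCast, map_ofNat]
  have hgeom := geom_sum_mul (PowerSeries.exp ℚ ^ p) a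
  have hne := exp_pow_sub_one_ne_zero hp
  have hinv := PowerSeries.mul_inv_cancel
    (PowerSeries.rescale ((p * a : ℕ) : ℚ) (bernoulliPowerSeries ℚ))
    (by rw [constantCoeff_rescale_bernoulliPowerSeries]; exact one_ne_zero)
  have hmem := inv_mem_bernoulliSubring (rescale_bernoulliPowerSeries_mem (p * a))
    (constantCoeff_rescale_bernoulliPowerSeries _)
  rw [← pow_mul] at hgeom
  rw [hE]
  set T := bernoulliPowerSeries ℚ
  set Ta := PowerSeries.rescale ((p * a : ℕ) : ℚ) T
  set Tp := PowerSeries.rescale (p : ℚ) T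
  set e := PowerSeries.exp ℚ
  set S := ∑ i ∈ Finset.range a, (e ^ p) ^ i
  push_cast at hT
  have hS : S * Ta = a * Tp := by
    refine mul_right_cancel₀ hne ?_
    linear_combination Ta * hgeom + hT - (a : PowerSeries ℚ) * hTp
  -- u = T(s)/T(pas), which is 1 mod q because pa ≡ 1.
  refine ⟨T * Ta⁻¹, ⟨-(g * Ta⁻¹), neg_mem (mul_mem hg hmem), ?_⟩, ?_⟩
  · linear_combination hinv - Ta⁻¹ * hgq
  · linear_combination (-(S * (e ^ p + 1) * T)) * hinv + (Ta⁻¹ * T * (e ^ p + 1)) * hS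
      + (a * Ta⁻¹ * T) * hTp - (p * PowerSeries.X * T * Ta⁻¹) * h2 - (Tp * T * Ta⁻¹) * h3

/-- The polynomial `∏ (X ^ p_i + 1) (X ^ (p_i a_i) - 1) / (X ^ p_i - 1)`. -/
noncomputable def cotPolynomial {N : ℕ} (p a : Fin N → ℕ) : Polynomial ℤ :=
  ∏ j, ((∑ i ∈ Finset.range (a j), (Polynomial.X ^ p j) ^ i) * (Polynomial.X ^ p j + 1))

/-- Each correction factor u_j is 1 mod q, and so is T(qs), by comparison with T(0 · s) = 1. The
constants 2 a_j contribute 2^n ∏ a_j. -/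
theorem coeff_cotPolynomial_exp {q n : ℕ} {p a : Fin n → ℕ} (hp : ∀ j, p j ≠ 0)
    (h : ∀ j, p j * a j ≡ 1 [MOD q]) :
    ∃ z : ℤ, (toddDenominator n n : ℚ) / 2 ^ n *
      PowerSeries.coeff n (Polynomial.aeval (PowerSeries.exp ℚ) (cotPolynomial p a) *
        bernoulliPowerSeries ℚ ^ n * PowerSeries.rescale (q : ℚ) (bernoulliPowerSeries ℚ)) =
      (∏ j, (a j : ℚ)) * (toddDenominator n n *
        PowerSeries.coeff n (∏ j, PowerSeries.rescale (p j : ℚ) evenBernoulliSeries)) + q * z := by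
  choose u hu huE using fun j => geom_sum_exp_mul (hp j) (h j)
  obtain ⟨g, hg, hgq⟩ := prod_eq_one_add_mul bernoulliSubring q Finset.univ u fun j _ => hu j
  obtain ⟨f, hf, hfq⟩ := rescale_bernoulliPowerSeries_congr (q := q) (a := q) (b := 0)
    (by simp [Nat.ModEq])
  have h0 : PowerSeries.rescale ((0 : ℕ) : ℚ) (bernoulliPowerSeries ℚ) = 1 := by
    rw [Nat.cast_zero, PowerSeries.rescale_zero, RingHom.comp_apply,
      constantCoeff_bernoulliPowerSeries, map_one]
  set E := ∏ j, PowerSeries.rescale (p j : ℚ) evenBernoulliSeries with hE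
  have hEmem : E ∈ bernoulliSubring := prod_mem fun j _ => rescale_evenBernoulliSeries_mem (p j)
  obtain ⟨z, hz⟩ := toddDenominator_mul_mem
    (mul_mem hEmem (add_mem (add_mem hg hf) (mul_mem (natCast_mem _ q) (mul_mem hg hf))) n)
  refine ⟨(∏ j, (a j : ℤ)) * z, ?_⟩
  have hprod : Polynomial.aeval (PowerSeries.exp ℚ) (cotPolynomial p a) *
      bernoulliPowerSeries ℚ ^ n * PowerSeries.rescale (q : ℚ) (bernoulliPowerSeries ℚ) =
      PowerSeries.C (2 ^ n * ∏ j, (a j : ℚ)) *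
        (E + PowerSeries.C (q : ℚ) * (E * (g + f + q * (g * f)))) := by
    have h1 : Polynomial.aeval (PowerSeries.exp ℚ) (cotPolynomial p a) *
        bernoulliPowerSeries ℚ ^ n = ∏ j, PowerSeries.C (2 * a j : ℚ) *
          (PowerSeries.rescale (p j : ℚ) evenBernoulliSeries * u j) := by
      rw [← Finset.prod_congr rfl fun j _ => huE j, Finset.prod_mul_distrib, Finset.prod_const,
        Finset.card_univ, Fintype.card_fin, cotPolynomial, map_prod]
      simp
    rw [h1, Finset.prod_mul_distrib, Finset.prod_mul_distrib, ← map_prod, hgq, ← hE, hfq, h0,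
      Finset.prod_mul_distrib, Finset.prod_const, Finset.card_univ, Fintype.card_fin, map_natCast]
    ring
  rw [hprod, PowerSeries.coeff_C_mul, map_add, PowerSeries.coeff_C_mul]
  push_cast
  rw [← hz]
  field_simp

/-! ### From cotangents to roots of unity -/

theorem cot_eq_root_ratio {q : ℕ} {ζ : ℂ} (hζ : ζ = Complex.exp (2 * Real.pi * Complex.I / q))
    (hq : 0 < q) {p : ℤ} {P : ℕ} (hP : (P : ZMod q) = (p : ZMod q)) (k : ℕ) :
    ((Real.cot (Real.pi * p * k / q) : ℝ) : ℂ) =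
      Complex.I * (((ζ ^ k) ^ P + 1) / ((ζ ^ k) ^ P - 1)) := by
  have hprim : IsPrimitiveRoot ζ q := hζ ▸ Complex.isPrimitiveRoot_exp q hq.ne'
  have hexp : Complex.exp (2 * Complex.I * ((Real.pi * p * k / q : ℝ) : ℂ)) = (ζ ^ k) ^ P := by
    have h1 : ζ ^ (p * k : ℤ) = ζ ^ ((P * k : ℕ) : ℤ) := by
      have h2 : (q : ℤ) ∣ p - P := by
        rw [← ZMod.intCast_eq_intCast_iff_dvd_sub, ← hP, Int.cast_natCast]
      obtain ⟨c, hc⟩ := h2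
      have h3 : p * k = ((P * k : ℕ) : ℤ) + q * (c * k) := by
        push_cast
        linear_combination (k : ℤ) * hc
      have h0 : ζ ≠ 0 := by
        rw [hζ]
        exact Complex.exp_ne_zero _
      rw [h3, zpow_add₀ h0, zpow_mul, zpow_natCast ζ q, hprim.pow_eq_one, one_zpow, mul_one]
    rw [zpow_natCast] at h1
    rw [← pow_mul, mul_comm k P, ← h1, hζ, ← Complex.exp_int_mul]
    congr 1
    push_cast
    ring
  rw [Complex.ofReal_cot, Complex.cot_eq_exp_ratio, hexp]
  have hI : Complex.I * (1 - (ζ ^ k) ^ P) = ((ζ ^ k) ^ P - 1) * Complex.I⁻¹ := by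
    rw [Complex.inv_I]
    ring
  rw [hI, div_mul_eq_div_div, div_inv_eq_mul, mul_comm]

/-- As (y^P)^a = y, the geometric sum is (y - 1)/(y^P - 1). -/
theorem root_ratio_eq {y : ℂ} (hy : y ≠ 1) {P a : ℕ} (h : y ^ (P * a) = y) :
    (y ^ P + 1) / (y ^ P - 1) =
      (∑ i ∈ Finset.range a, (y ^ P) ^ i) * (y ^ P + 1) / (y - 1) := by
  have h1 : y ^ P ≠ 1 := fun h1 => hy (by rw [← h, pow_mul, h1, one_pow])
  rw [div_eq_div_iff (sub_ne_zero.2 h1) (sub_ne_zero.2 hy)]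
  have h2 := geom_sum_mul (y ^ P) a
  rw [← pow_mul, h] at h2
  linear_combination (-(y ^ P + 1)) * h2

theorem zagierSum_eq_sum_aeval {q n : ℕ} {ζ : ℂ}
    (hζ : ζ = Complex.exp (2 * Real.pi * Complex.I / q)) (hq : 0 < q) (hn : Even (n + 1))
    (p : Fin n → ℤ) {P a : Fin (n + 1) → ℕ} (hlast : P (Fin.last n) = 1)
    (hP : ∀ i : Fin n, (P i.castSucc : ZMod q) = (p i : ZMod q))
    (ha : ∀ j, P j * a j ≡ 1 [MOD q]) :
    ((zagierSum (n := n + 1) q p : ℝ) : ℂ) = ∑ k ∈ Finset.Ico 1 q,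
      Polynomial.aeval (ζ ^ k) (cotPolynomial P a) / (ζ ^ k - 1) ^ (n + 1) := by
  have hprim : IsPrimitiveRoot ζ q := hζ ▸ Complex.isPrimitiveRoot_exp q hq.ne'
  rw [zagierSum, cotSum]
  simp only [Complex.ofReal_mul, Complex.ofReal_pow, Complex.ofReal_neg,
    Complex.ofReal_one, Complex.ofReal_sum, Complex.ofReal_prod]
  rw [Finset.mul_sum]
  refine Finset.sum_congr rfl fun k hk => ?_
  have h1 := cot_eq_root_ratio hζ hq (p := 1) (P := 1) (by simp) k
  rw [Int.cast_one, mul_one] at h1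
  change _ * (_ * ∏ i : Fin n, ((Real.cot (Real.pi * p i * k / q) : ℝ) : ℂ)) = _
  rw [h1, Finset.prod_congr rfl fun i _ => cot_eq_root_ratio hζ hq (hP i) k]
  -- Each cotangent contributes a factor `Complex.I`; together they cancel the sign in `zagierSum`.
  have hI : (-1 : ℂ) ^ ((n + 1) / 2) * Complex.I ^ (n + 1) = 1 := by
    obtain ⟨r, hr⟩ := hn
    rw [hr, ← two_mul, Nat.mul_div_cancel_left _ two_pos, pow_mul, Complex.I_sq, ← mul_pow]
    simp
  have hprod : ∏ j, (((ζ ^ k) ^ P j + 1) / ((ζ ^ k) ^ P j - 1)) =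
      Polynomial.aeval (ζ ^ k) (cotPolynomial P a) / (ζ ^ k - 1) ^ (n + 1) := by
    have h2 : ∀ j ∈ Finset.univ, ((ζ ^ k) ^ P j + 1) / ((ζ ^ k) ^ P j - 1) =
        (∑ i ∈ Finset.range (a j), ((ζ ^ k) ^ P j) ^ i) * ((ζ ^ k) ^ P j + 1) / (ζ ^ k - 1) := by
      intro j _
      refine root_ratio_eq (pow_ne_one_of_mem_Ico hprim hk) ?_
      have h3 : (ζ ^ k) ^ q = 1 := by rw [← pow_mul, mul_comm, pow_mul, hprim.pow_eq_one, one_pow]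
      rw [pow_eq_pow_mod _ h3, ha j, ← pow_eq_pow_mod _ h3, pow_one]
    rw [Finset.prod_congr rfl h2, Finset.prod_div_distrib, Finset.prod_const, Finset.card_univ,
      Fintype.card_fin, cotPolynomial, map_prod]
    simp
  rw [← hprod, Fin.prod_univ_castSucc, hlast, Finset.prod_mul_distrib, Finset.prod_const,
    Finset.card_univ, Fintype.card_fin]
  linear_combination (∏ i : Fin n, (((ζ ^ k) ^ P i.castSucc + 1) / ((ζ ^ k) ^ P i.castSucc - 1))) *
    (((ζ ^ k) ^ 1 + 1) / ((ζ ^ k) ^ 1 - 1)) * hI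

/-! ### Identification of the residue sum and conclusion -/

theorem toddDenominator_mul_coeff_prod {n : ℕ} (P : Fin n → ℕ) :
    (toddDenominator n n : ℚ) *
      PowerSeries.coeff n (∏ j, PowerSeries.rescale (P j : ℚ) evenBernoulliSeries) =
      ((∑ m ∈ evenIndices n, scaledCoeff n m * ∏ j, (P j : ℤ) ^ m j : ℤ) : ℚ) := by
  rw [PowerSeries.coeff_prod]
  have h1 : ∑ l ∈ Finset.finsuppAntidiag Finset.univ n, ∏ j,
      PowerSeries.coeff (l j) (PowerSeries.rescale (P j : ℚ) evenBernoulliSeries) =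
      ∑ m ∈ Finset.piAntidiag (Finset.univ : Finset (Fin n)) n, ∏ j,
        PowerSeries.coeff (m j) (PowerSeries.rescale (P j : ℚ) evenBernoulliSeries) := by
    refine Finset.sum_bij (fun l _ => (l : Fin n → ℕ)) ?_ ?_ ?_ ?_
    · intro l hl
      simpa using hl
    · intro l _ l' _ h
      exact DFunLike.coe_injective h
    · intro m hm
      exact ⟨Finsupp.equivFunOnFinite.symm m, by simpa using hm, by simp⟩
    · intro l _
      rfl
  rw [h1, evenIndices, Finset.sum_filter, Finset.mul_sum]
  push_cast
  refine Finset.sum_congr rfl fun m hm => ?_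
  simp only [PowerSeries.coeff_rescale, coeff_evenBernoulliSeries, Finset.prod_mul_distrib]
  split_ifs with he
  · rw [coe_scaledCoeff m (by simpa using hm), bernoulliQuotient,
      Finset.prod_congr rfl fun i _ => if_pos (he i)]
    ring
  · push Not at he
    obtain ⟨i, hi⟩ := he
    rw [Finset.prod_eq_zero (f := fun i => if Even (m i) then bernoulli (m i) / ((m i).factorial : ℚ)
      else 0) (Finset.mem_univ i) (if_neg hi)]
    simp

/-- Modulo q, a_j inverts P_j, so p_i^{m_i - 1} = a_i P_i^{m_i}; the last index contributes 1. -/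
theorem residueSum_eq {q n : ℕ} (p : Fin n → ℤ) (hp : ∀ i, IsCoprime (p i) (q : ℤ))
    {P a : Fin (n + 1) → ℕ} (hlast : P (Fin.last n) = 1)
    (hP : ∀ i : Fin n, (P i.castSucc : ZMod q) = (p i : ZMod q))
    (ha : ∀ j, P j * a j ≡ 1 [MOD q]) :
    residueSum (n := n + 1) q p hp = (∏ j, (a j : ZMod q)) *
      ((∑ m ∈ evenIndices (n + 1), scaledCoeff (n + 1) m * ∏ j, (P j : ℤ) ^ m j : ℤ) : ZMod q) := by
  have ha' : ∀ j, (P j : ZMod q) * a j = 1 := fun j => by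
    have h := (ZMod.natCast_eq_natCast_iff _ _ _).2 (ha j)
    exact_mod_cast h
  rw [residueSum]
  push_cast
  rw [Finset.mul_sum]
  refine Finset.sum_congr rfl fun m _ => ?_
  rw [mul_left_comm, ← Finset.prod_mul_distrib, Fin.prod_univ_castSucc]
  have h1 := ha' (Fin.last n)
  rw [hlast, Nat.cast_one, one_mul] at h1
  rw [h1, hlast, Nat.cast_one, one_pow, mul_one, mul_one]
  congr 1
  refine Finset.prod_congr rfl fun i _ => ?_
  have h2 : ((ZMod.unitOfIsCoprime (p i) (hp i) : (ZMod q)ˣ) : ZMod q) = P i.castSucc := by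
    rw [ZMod.coe_unitOfIsCoprime, hP]
  have h3 : (((ZMod.unitOfIsCoprime (p i) (hp i))⁻¹ : (ZMod q)ˣ) : ZMod q) = a i.castSucc :=
    Units.inv_eq_of_mul_eq_one_right (by rw [h2, ha'])
  rw [zpow_sub, zpow_natCast, zpow_one, Units.val_mul, Units.val_pow_eq_pow_val, h2, h3, mul_comm]
  rfl

theorem exists_zagierSum_eq {n q : ℕ} (hn : Even (n + 1)) (hq : 0 < q) (p : Fin n → ℤ)
    (hp : ∀ i, IsCoprime (p i) (q : ℤ)) :
    ∃ b : ℤ, (b : ℝ) = (toddDenominator (n + 1) (n + 1) : ℝ) / 2 ^ (n + 1) *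
        zagierSum (n := n + 1) q p ∧
      (b : ZMod q) = -residueSum (n := n + 1) q p hp := by
  have : NeZero q := ⟨hq.ne'⟩
  set u : Fin n → (ZMod q)ˣ := fun i => ZMod.unitOfIsCoprime (p i) (hp i) with hu
  obtain ⟨P, a, hlast, hP, hP0, ha⟩ : ∃ P a : Fin (n + 1) → ℕ, P (Fin.last n) = 1 ∧
      (∀ i : Fin n, (P i.castSucc : ZMod q) = (p i : ZMod q)) ∧ (∀ j, P j ≠ 0) ∧
      ∀ j, P j * a j ≡ 1 [MOD q] := by
    -- Adding q keeps the representative nonzero even when q = 1, where the residue is 0; e^{Ps} - 1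
    -- must be a nonzero series.
    refine ⟨Fin.snoc (α := fun _ => ℕ) (fun i => (u i : ZMod q).val + q) 1,
      Fin.snoc (α := fun _ => ℕ) (fun i => ((u i)⁻¹ : (ZMod q)ˣ).val.val) 1, ?_, ?_, ?_, ?_⟩
    · simp
    · intro i
      simp [hu]
    · intro j
      refine Fin.lastCases ?_ (fun i => ?_) j
      · simp
      · simp [hq.ne']
    · intro j
      refine Fin.lastCases ?_ (fun i => ?_) j
      · simp [Nat.ModEq]
      · rw [← ZMod.natCast_eq_natCast_iff]
        simp only [Fin.snoc_castSucc]
        push_cast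
        rw [ZMod.natCast_zmod_val, ZMod.natCast_zmod_val, ZMod.natCast_self, add_zero,
          Units.mul_inv]
  set ζ := Complex.exp (2 * Real.pi * Complex.I / q) with hζ
  have hprim : IsPrimitiveRoot ζ q := Complex.isPrimitiveRoot_exp q hq.ne'
  obtain ⟨z, hz⟩ := exists_rootSumDefect_eq hq hprim (n + 1) (cotPolynomial P a)
  rw [rootSumDefect_apply, ← zagierSum_eq_sum_aeval hζ hq hn p hlast hP ha] at hz
  obtain ⟨w, hw⟩ := coeff_cotPolynomial_exp hP0 ha
  obtain ⟨D, hD⟩ := exists_toddDenominator_eq (n + 1)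
  rw [toddDenominator_mul_coeff_prod] at hw
  rw [residueSum_eq p hp hlast hP ha]
  set W := ∑ m ∈ evenIndices (n + 1), scaledCoeff (n + 1) m * ∏ j, (P j : ℤ) ^ m j
  -- D = d/2^n multiplies the defect q z, from which the scaled coefficient at 1 is subtracted; only
  -- -(∏ a_j) W survives mod q.
  refine ⟨D * (q * z) - ((∏ j, (a j : ℤ)) * W + q * w), ?_, ?_⟩
  · have hDq : (toddDenominator (n + 1) (n + 1) : ℚ) / 2 ^ (n + 1) = D := by
      rw [hD]
      field_simp
    have hDr : (toddDenominator (n + 1) (n + 1) : ℝ) / 2 ^ (n + 1) = D := by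
      have hD' : (toddDenominator (n + 1) (n + 1) : ℝ) = 2 ^ (n + 1) * D := by exact_mod_cast hD
      rw [hD']
      field_simp
    rw [hDq] at hw
    rw [hDr]
    have hwc := congrArg (Rat.cast (K := ℂ)) hw
    push_cast at hwc
    apply Complex.ofReal_injective
    push_cast
    linear_combination (-(D : ℂ)) * hz + hwc
  · push_cast
    rw [ZMod.natCast_self]
    ring

end DedekindZagier

theorem mainTheorem10 (n : ℕ) (hn : 2 ≤ n) (hn_even : Even n) (q : ℕ) (hq : 0 < q)
    (p : Fin (n - 1) → ℤ) (hp : ∀ i, IsCoprime (p i) (q : ℤ)) :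
    (∃ a : ℤ,
      (a : ℝ) = (DedekindZagier.toddDenominator n n : ℝ) / 2 ^ n *
        DedekindZagier.cotSum (n := n) q p ∧
      (a : ZMod q) = (-1) ^ (n / 2 + 1) * DedekindZagier.residueSum (n := n) q p hp) ∧
    (∃ b : ℤ,
      (b : ℝ) = (DedekindZagier.toddDenominator n n : ℝ) / 2 ^ n *
        DedekindZagier.zagierSum (n := n) q p ∧
      (b : ZMod q) = -DedekindZagier.residueSum (n := n) q p hp) := by
  obtain ⟨k, rfl⟩ : ∃ k, n = k + 1 := ⟨n - 1, by omega⟩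
  obtain ⟨b, hb, hb'⟩ := DedekindZagier.exists_zagierSum_eq hn_even hq p hp
  refine ⟨⟨(-1) ^ ((k + 1) / 2) * b, ?_, ?_⟩, b, hb, hb'⟩
  · have h1 : ((-1 : ℝ) ^ ((k + 1) / 2)) * (-1) ^ ((k + 1) / 2) = 1 := by
      rw [← mul_pow]
      simp
    push_cast
    rw [hb, DedekindZagier.zagierSum]
    linear_combination ((DedekindZagier.toddDenominator (k + 1) (k + 1) : ℝ) / 2 ^ (k + 1) *
      DedekindZagier.cotSum (n := k + 1) q p) * h1
  · push_cast
    rw [hb', pow_succ]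
    ring
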